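/- **Theorem 4.1.** Let $n\ge 0$ and let $a_0,\dots,a_n$ be positive integers. On $\mathbb{C}^{n+1}$ with coordinates $z_j=x_j+iy_j$ put $$\alpha=\tfrac14\sum_{j=0}^n a_j(x_j\,dy_j-y_j\,dx_j),\qquad Z=4i\sum_{j=0}^n\frac1{a_j}\Big(z_j\frac{\partial}{\partial z_j}-\bar z_j\frac{\partial}{\partial\bar z_j}\Big),$$ and let $$S^{2n+1}=\Big\{z:\sum_j|z_j|^2=1\Big\},\qquad B=\Big\{z:\sum_j|z_j|^2=1,\ \sum_j z_j^{a_j}=0\Big\}$$ ($B$ is the Brieskorn manifold; it is empty for $n=0$ and need not be connected). Let $$V_1=2i\sum_{j}\Big(\bar z_j^{\,a_j-1}\frac{\partial}{\partial z_j}-z_j^{a_j-1}\frac{\partial}{\partial\bar z_j}\Big),\quad V_2=-2\sum_{j}\Big(\bar z_j^{\,a_j-1}\frac{\partial}{\partial z_j}+z_j^{a_j-1}\frac{\partial}{\partial\bar z_j}\Big),\quad \mu=2\sum_j a_j|z_j|^{2(a_j-1)}.$$ For a contact form $\alpha$ on a manifold $M$ with Reeb field $Z_M$ (that is, $i_{Z_M}\alpha=1$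 and $i_{Z_M}d\alpha=0$ on $M$), the contact Hamiltonian vector field of $f\in C^\infty(M)$ is $Y_f=fZ_M+\hat Y_f$, where $\hat Y_f$ is tangent to $M$ with $\alpha(\hat Y_f)=0$ and $-i_{\hat Y_f}d\alpha=df-Z_M(f)\,\alpha$, and the Jacobi bracket is $[f,g]=d\alpha(Y_f,Y_g)+f\,Z_M(g)-g\,Z_M(f)$. Here "contact" means that $M$ is an embedded submanifold transverse to $\ker\alpha$ and that $d\alpha$ is nondegenerate on $\ker\alpha\cap TM$. Then $(S^{2n+1},\alpha)$ is a contact manifold of dimension $2n+1$, and $(B,\alpha)$ is a contact manifold, of dimension $2n-1$ when $n\ge1$; $Z$ restricts to the Reeb vector field of each of them; at every point of $B$ the vectors $V_1,V_2$ are tangent to $S^{2n+1}$ and $$\mu=2\sum_j a_j\big(|z_j|^2\big)^{a_j-1}\neq0.$$ Moreover, for all smooth functions $f,g$ on $S^{2n+1}$ with $Z(f)=Z(g)=0$ on $S^{2n+1}$, at every point of $B$, $$[f|_B,g|_B]_B=[f,g]+\frac{df(V_2)\,dg(V_1)-df(V_1)\,dg(V_2)}{\mu},$$ where $[\cdot,\cdot]_B$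 is the Jacobi bracket on $(B,\alpha)$ and $[\cdot,\cdot]$ is the Jacobi bracket on $(S^{2n+1},\alpha)$. -/

import Mathlib

open scoped Topology ContDiff

noncomputable section

namespace ContactGeometry

variable {E : Type*} [NormedAddCommGroup E] [NormedSpace ℝ E]

/-- `M` is a smooth embedded `d`-dimensional submanifold of `E`: near each of its points it is the
zero set of a smooth map to some `ℝ^k` which is a submersion at that point, where
`k + d = dim E`. -/
def IsSubmanifold (M : Set E) (d : ℕ) : Prop :=
  ∀ x ∈ M, ∃ (k : ℕ) (U : Set E) (Φ : E → (Fin k → ℝ)),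
    k + d = Module.finrank ℝ E ∧ IsOpen U ∧ x ∈ U ∧ ContDiffOn ℝ ∞ Φ U ∧
    Function.Surjective (fderiv ℝ Φ x) ∧ M ∩ U = {y ∈ U | Φ y = 0}

/-- The tangent space `T_x M` of a submanifold `M ⊆ E`, seen inside `E`: the velocities at time `0`
of the curves that run in `M`, pass through `x` at time `0` and are differentiable there. -/
def tangentSpaceAt (M : Set E) (x : E) : Set E :=
  {v | ∃ γ : ℝ → E, γ 0 = x ∧ (∀ᶠ t in 𝓝 (0 : ℝ), γ t ∈ M) ∧ HasDerivAt γ v 0}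

/-- A smooth function on `M`, represented by a function on `E` of which only the values on `M`
matter: near each point of `M` it is the restriction of a smooth function on an open set of `E`. -/
def IsSmoothOn (M : Set E) (f : E → ℝ) : Prop :=
  ∀ x ∈ M, ∃ (U : Set E) (F : E → ℝ), IsOpen U ∧ x ∈ U ∧ ContDiffOn ℝ ∞ F U ∧ Set.EqOn F f (U ∩ M)

/-- The differential `df_x(v)` of a function on `M` in the direction `v ∈ T_x M`. For tangent `v`
its value is that of `v` applied to any local smooth extension, see `hasDerivAt_comp_curve`. -/
def differential (M : Set E) (f : E → ℝ) (x v : E) : ℝ := fderivWithin ℝ f M x v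

/-- `differential` is the derivative along every curve in `M` with the given velocity; in particular
it depends only on the values of `f` on `M`. -/
theorem hasDerivAt_comp_curve {M : Set E} {f : E → ℝ} (hf : IsSmoothOn M f) {x v : E} (hx : x ∈ M)
    {γ : ℝ → E} (h0 : γ 0 = x) (hM : ∀ᶠ t in 𝓝 (0 : ℝ), γ t ∈ M) (hγ : HasDerivAt γ v 0) :
    HasDerivAt (fun t => f (γ t)) (differential M f x v) 0 := by
  obtain ⟨U, F, hU, hxU, hF, hEq⟩ := hf x hx
  have hFd : DifferentiableWithinAt ℝ F M x :=
    ((hF.contDiffAt (hU.mem_nhds hxU)).differentiableAt (by simp)).differentiableWithinAt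
  have hfd : DifferentiableWithinAt ℝ f M x := by
    refine hFd.congr_of_eventuallyEq ?_ (hEq ⟨hxU, hx⟩).symm
    filter_upwards [self_mem_nhdsWithin, mem_nhdsWithin_of_mem_nhds (hU.mem_nhds hxU)]
      with y hy hyU
    exact (hEq ⟨hyU, hy⟩).symm
  subst h0
  have h1 := hfd.hasFDerivWithinAt.comp_hasDerivWithinAt (s := γ ⁻¹' M) (0 : ℝ)
    hγ.hasDerivWithinAt (fun t ht => ht)
  exact h1.hasDerivAt hM

/-- The exterior derivative `dα_x(v, w)` of a one-form on `E`. Restricted to tangent vectors of a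
submanifold it is the exterior derivative of the pulled back form. -/
def dForm (α : E → E →L[ℝ] ℝ) (x v w : E) : ℝ := fderiv ℝ α x v w - fderiv ℝ α x w v

/-- `(M, α|_M)` is a co-oriented contact manifold of dimension `2 * m + 1`: `M` is a submanifold
transverse to `ker α`, and `dα` is nondegenerate on `ker α ∩ T_x M`. -/
structure IsContact (M : Set E) (α : E → E →L[ℝ] ℝ) (m : ℕ) : Prop where
  contDiff : ContDiff ℝ ∞ α
  submanifold : IsSubmanifold M (2 * m + 1)
  transverse : ∀ x ∈ M, ∃ v ∈ tangentSpaceAt M x, α x v ≠ 0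
  nondegenerate : ∀ x ∈ M, ∀ v ∈ tangentSpaceAt M x, α x v = 0 →
    (∀ w ∈ tangentSpaceAt M x, α x w = 0 → dForm α x v w = 0) → v = 0

/-- `Z` is the value at `x` of the Reeb vector field of `(M, α|_M)`:
`i_Z α = 1` and `i_Z dα = 0`. -/
def IsReebAt (M : Set E) (α : E → E →L[ℝ] ℝ) (x Z : E) : Prop :=
  Z ∈ tangentSpaceAt M x ∧ α x Z = 1 ∧ ∀ w ∈ tangentSpaceAt M x, dForm α x Z w = 0

/-- The Reeb vector field of the contact manifold `(M, α|_M)`. -/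
def reeb (M : Set E) (α : E → E →L[ℝ] ℝ) (x : E) : E :=
  Classical.epsilon fun Z => IsReebAt M α x Z

/-- The horizontal part `Ŷ_f` of the contact Hamiltonian vector field: the horizontal tangent vector
with `- i_Ŷ dα = df - (Z f) α`. -/
def horizontalHam (M : Set E) (α : E → E →L[ℝ] ℝ) (f : E → ℝ) (x : E) : E :=
  Classical.epsilon fun Y => Y ∈ tangentSpaceAt M x ∧ α x Y = 0 ∧
    ∀ w ∈ tangentSpaceAt M x, - dForm α x Y w =
      differential M f x w - differential M f x (reeb M α x) * α x w

/-- The contact Hamiltonian vector field `Y_f = f Z + Ŷ_f` on `(M, α|_M)`. -/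
def contactHam (M : Set E) (α : E → E →L[ℝ] ℝ) (f : E → ℝ) (x : E) : E :=
  f x • reeb M α x + horizontalHam M α f x

/-- The Jacobi bracket `[f, g] = dα(Y_f, Y_g) + f Z(g) - g Z(f)` on `(M, α|_M)`. -/
def jacobiBracket (M : Set E) (α : E → E →L[ℝ] ℝ) (f g : E → ℝ) (x : E) : ℝ :=
  dForm α x (contactHam M α f x) (contactHam M α g x)
    + f x * differential M g x (reeb M α x) - g x * differential M f x (reeb M α x)

end ContactGeometry

namespace Brieskorn

variable {n : ℕ}

/-- The unit sphere `S^{2n+1}` in `ℂ^{n+1}`. -/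
def unitSphere (n : ℕ) : Set (Fin (n + 1) → ℂ) := {z | ∑ j, ‖z j‖ ^ 2 = 1}

/-- The Brieskorn manifold `B`. -/
def manifold (a : Fin (n + 1) → ℕ) : Set (Fin (n + 1) → ℂ) :=
  {z | ∑ j, ‖z j‖ ^ 2 = 1 ∧ ∑ j, z j ^ a j = 0}

/-- The one-form `α = ¼ ∑ a_j (x_j dy_j - y_j dx_j)` on `ℂ^{n+1}`, where `z_j = x_j + i y_j`. -/
def form (a : Fin (n + 1) → ℕ) (z : Fin (n + 1) → ℂ) : (Fin (n + 1) → ℂ) →L[ℝ] ℝ :=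
  (1 / 4 : ℝ) • ∑ j, (a j : ℝ) •
    ((z j).re • (Complex.imCLM ∘L ContinuousLinearMap.proj (R := ℝ) (φ := fun _ => ℂ) j)
      - (z j).im • (Complex.reCLM ∘L ContinuousLinearMap.proj (R := ℝ) (φ := fun _ => ℂ) j))

/-- The vector field `4 i ∑ (1 / a_j) (z_j ∂/∂z_j - z̄_j ∂/∂z̄_j)`. A real vector field
`∑ (c_j ∂/∂z_j + c̄_j ∂/∂z̄_j)` is identified with `(c_j)_j`. -/
def reebField (a : Fin (n + 1) → ℕ) (z : Fin (n + 1) → ℂ) : Fin (n + 1) → ℂ :=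
  fun j => 4 * Complex.I / (a j : ℂ) * z j

/-- `V_1 = 2 i ∑ (z̄_j^{a_j - 1} ∂/∂z_j - z_j^{a_j - 1} ∂/∂z̄_j)`. -/
def V₁ (a : Fin (n + 1) → ℕ) (z : Fin (n + 1) → ℂ) : Fin (n + 1) → ℂ :=
  fun j => 2 * Complex.I * (starRingEnd ℂ (z j)) ^ (a j - 1)

/-- `V_2 = - 2 ∑ (z̄_j^{a_j - 1} ∂/∂z_j + z_j^{a_j - 1} ∂/∂z̄_j)`. -/
def V₂ (a : Fin (n + 1) → ℕ) (z : Fin (n + 1) → ℂ) : Fin (n + 1) → ℂ :=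
  fun j => -2 * (starRingEnd ℂ (z j)) ^ (a j - 1)

/-- `μ = 2 ∑ a_j |z_j|^{2 (a_j - 1)}`. -/
def mu (a : Fin (n + 1) → ℕ) (z : Fin (n + 1) → ℂ) : ℝ :=
  2 * ∑ j, (a j : ℝ) * ‖z j‖ ^ (2 * (a j - 1))

end Brieskorn

end

/-!
Write `⟪·, ·⟫_a` for the Hermitian form on `ℂ^{n+1}` with weights `a_j`, so that
`α_z(v) = ¼ Im ⟪z, v⟫_a` and `dα(v, w) = ½ Im ⟪v, w⟫_a`. If `v` is horizontal, then
`dα(v, ·)` vanishes at `z`, hence takes the value `½ ⟪v, v⟫_a` not only at `i v` but also at the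
component of `i v` tangent to the sphere; so the sphere is contact.

Up to factors, `V₁` and `V₂` are `i` and `1` times the gradient of `∑ z_j ^ a_j` for `⟪·, ·⟫_a`.
Therefore `T_z B` is the `dα`-orthogonal complement of `V₁` and `V₂` in `T_z S`, and
`dα(V₁, V₂) = μ ≠ 0`, so `T_z S` splits into this complement and the span of `V₁` and `V₂`.
Nondegeneracy and the Reeb vector pass to the complement, and the horizontal Hamiltonian vectors on
`B` are the projections of those on the sphere. The removed components pair to the correction term.
-/

open RCLike (wInner)
open scoped ComplexConjugate

noncomputable section

namespace ContactGeometry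

section LinearContact

variable {K E : Type*} [Field K] [AddCommGroup E] [Module K E]

/-- The linear model of a contact manifold at a point: `T` is the tangent space, `α` the contact
form, `Ω` its exterior derivative and `Z` the Reeb vector. Since `Ω Z` vanishes on `T`, the
nondegeneracy of `Ω` on `T ⊓ ker α` can be tested against all vectors of `T`. -/
structure IsLinearContact (T : Submodule K E) (α : Module.Dual K E) (Ω : LinearMap.BilinForm K E)
    (Z : E) : Prop where
  isAlt : Ω.IsAlt
  reeb_mem : Z ∈ T
  form_reeb : α Z = 1
  reeb_left : ∀ w ∈ T, Ω Z w = 0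
  nondegenerate : ∀ v ∈ T, α v = 0 → (∀ w ∈ T, Ω v w = 0) → v = 0

/-- The `Ω`-orthogonal complement of `V` and `W` in `T`. -/
def skewComplement (T : Submodule K E) (Ω : LinearMap.BilinForm K E) (V W : E) : Submodule K E :=
  T ⊓ (Ω V).ker ⊓ (Ω W).ker

/-- The projection to the `Ω`-orthogonal complement of `V` and `W` along their span. It is
meaningful for `Ω V W ≠ 0`. -/
def skewProjection (Ω : LinearMap.BilinForm K E) (V W w : E) : E :=
  w + (Ω W w / Ω V W) • V - (Ω V w / Ω V W) • W

variable {T : Submodule K E} {α : Module.Dual K E} {Ω : LinearMap.BilinForm K E} {V W Z : E}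

theorem mem_skewComplement {v : E} :
    v ∈ skewComplement T Ω V W ↔ v ∈ T ∧ Ω V v = 0 ∧ Ω W v = 0 := by
  simp only [skewComplement, Submodule.mem_inf, LinearMap.mem_ker, and_assoc]

theorem apply_skewProjection (u w : E) :
    Ω u (skewProjection Ω V W w) =
      Ω u w + Ω W w / Ω V W * Ω u V - Ω V w / Ω V W * Ω u W := by
  simp only [skewProjection, map_add, map_sub, map_smul, smul_eq_mul]

theorem skewProjection_mem (hΩ : Ω.IsAlt) (hV : V ∈ T) (hW : W ∈ T) (hVW : Ω V W ≠ 0) {w : E}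
    (hw : w ∈ T) : skewProjection Ω V W w ∈ skewComplement T Ω V W := by
  refine mem_skewComplement.2
    ⟨T.sub_mem (T.add_mem hw (T.smul_mem _ hV)) (T.smul_mem _ hW), ?_, ?_⟩
  · rw [apply_skewProjection, hΩ.self_eq_zero, div_mul_cancel₀ _ hVW]
    ring
  · rw [apply_skewProjection, hΩ.self_eq_zero, ← hΩ.neg_eq V W, mul_neg, div_mul_cancel₀ _ hVW]
    ring

theorem apply_skewProjection_of_mem (hΩ : Ω.IsAlt) {u : E} (hu : u ∈ skewComplement T Ω V W)
    (w : E) : Ω u (skewProjection Ω V W w) = Ω u w := by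
  obtain ⟨-, hVu, hWu⟩ := mem_skewComplement.1 hu
  rw [apply_skewProjection, ← hΩ.neg_eq V u, ← hΩ.neg_eq W u, hVu, hWu]
  ring

/-- The vectors `F'`, `G'` play the role of the Hamiltonian vectors on the smaller space of the
functions whose Hamiltonian vectors on `T` are `F`, `G`. -/
theorem apply_eq_of_eqOn_skewComplement (hΩ : Ω.IsAlt) (hV : V ∈ T) (hW : W ∈ T)
    (hVW : Ω V W ≠ 0) {F G F' G' : E} (hG : G ∈ T) (hF' : F' ∈ skewComplement T Ω V W)
    (hFF' : ∀ w ∈ skewComplement T Ω V W, Ω F' w = Ω F w)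
    (hGG' : ∀ w ∈ skewComplement T Ω V W, Ω G' w = Ω G w) :
    Ω F' G' = Ω F G + (Ω F W * Ω G V - Ω F V * Ω G W) / Ω V W :=
  calc
    Ω F' G' = Ω F' G := by rw [← hΩ.neg_eq G' F', hGG' F' hF', hΩ.neg_eq]
    _ = Ω F' (skewProjection Ω V W G) := (apply_skewProjection_of_mem hΩ hF' G).symm
    _ = Ω F (skewProjection Ω V W G) := hFF' _ (skewProjection_mem hΩ hV hW hVW hG)
    _ = Ω F G + (Ω F W * Ω G V - Ω F V * Ω G W) / Ω V W := by
      rw [apply_skewProjection, ← hΩ.neg_eq G V, ← hΩ.neg_eq G W]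
      ring

namespace IsLinearContact

theorem reeb_right (h : IsLinearContact T α Ω Z) {v : E} (hv : v ∈ T) : Ω v Z = 0 := by
  rw [← h.isAlt.neg_eq, h.reeb_left v hv, neg_zero]

theorem eq_zero_of_horizontal (h : IsLinearContact T α Ω Z) {v : E} (hv : v ∈ T) (hαv : α v = 0)
    (hΩv : ∀ w ∈ T, α w = 0 → Ω v w = 0) : v = 0 := by
  refine h.nondegenerate v hv hαv fun w hw => ?_
  have hproj := hΩv (w - α w • Z) (T.sub_mem hw (T.smul_mem _ h.reeb_mem)) (by simp [h.form_reeb])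
  simpa [h.reeb_right hv] using hproj

theorem reeb_unique (h : IsLinearContact T α Ω Z) {Z' : E} (hZ' : Z' ∈ T) (hαZ' : α Z' = 1)
    (hΩZ' : ∀ w ∈ T, Ω Z' w = 0) : Z' = Z :=
  sub_eq_zero.1 <| h.nondegenerate _ (T.sub_mem hZ' h.reeb_mem)
    (by rw [map_sub, hαZ', h.form_reeb, sub_self])
    fun w hw => by rw [map_sub, LinearMap.sub_apply, hΩZ' w hw, h.reeb_left w hw, sub_self]

theorem exists_horizontal [FiniteDimensional K T] (h : IsLinearContact T α Ω Z)
    (D : Module.Dual K E) :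
    ∃ Y ∈ T, α Y = 0 ∧ ∀ w ∈ T, -Ω Y w = D w - D Z * α w := by
  -- `Ω + α ⊗ α` is nondegenerate on `T`, so it represents `D Z • α - D`; testing at `Z` shows that
  -- the representing vector is horizontal.
  let flat : T →ₗ[K] Module.Dual K T := (Ω + (LinearMap.mul K K).compl₁₂ α α).domRestrict₁₂ T T
  have flat_apply (v w : T) : flat v w = Ω v w + α v * α w := rfl
  have flat_reeb (v : T) : flat v ⟨Z, h.reeb_mem⟩ = α v := by
    rw [flat_apply, h.reeb_right v.2, h.form_reeb, zero_add, mul_one]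
  have hinj : Function.Injective flat := by
    refine (injective_iff_map_eq_zero flat).2 fun v hv => ?_
    have hαv : α v = 0 := by rw [← flat_reeb, hv, LinearMap.zero_apply]
    refine Subtype.ext (h.nondegenerate v v.2 hαv fun w hw => ?_)
    simpa [flat_apply, hαv] using LinearMap.congr_fun hv ⟨w, hw⟩
  obtain ⟨Y, hY⟩ := (LinearMap.injective_iff_surjective_of_finrank_eq_finrank
    Subspace.dual_finrank_eq.symm).1 hinj ((D Z • α - D).domRestrict T)
  have hαY : α Y = 0 := by rw [← flat_reeb, hY]; simp [h.form_reeb]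
  refine ⟨Y, Y.2, hαY, fun w hw => ?_⟩
  have hYw := LinearMap.congr_fun hY ⟨w, hw⟩
  simp only [flat_apply, hαY, LinearMap.domRestrict_apply, LinearMap.sub_apply,
    LinearMap.smul_apply, smul_eq_mul] at hYw
  linear_combination -hYw

theorem skewComplement (h : IsLinearContact T α Ω Z) (hV : V ∈ T) (hW : W ∈ T)
    (hVW : Ω V W ≠ 0) : IsLinearContact (skewComplement T Ω V W) α Ω Z where
  isAlt := h.isAlt
  reeb_mem := mem_skewComplement.2 ⟨h.reeb_mem, h.reeb_right hV, h.reeb_right hW⟩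
  form_reeb := h.form_reeb
  reeb_left w hw := h.reeb_left w (mem_skewComplement.1 hw).1
  nondegenerate v hv hαv hΩv := h.nondegenerate v (mem_skewComplement.1 hv).1 hαv fun w hw => by
    rw [← apply_skewProjection_of_mem h.isAlt hv w]
    exact hΩv _ (skewProjection_mem h.isAlt hV hW hVW hw)

end IsLinearContact

end LinearContact

section LevelSet

variable {E F : Type*} [NormedAddCommGroup E] [NormedSpace ℝ E] [NormedAddCommGroup F]
  [NormedSpace ℝ F] {Φ : E → F}

theorem apply_eq_zero_of_mem_tangentSpaceAt {Φ' : E →L[ℝ] F} {x v : E}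
    (hΦ : HasFDerivAt Φ Φ' x) (hv : v ∈ tangentSpaceAt {y | Φ y = Φ x} x) : Φ' v = 0 := by
  obtain ⟨γ, rfl, hγΦ, hγ⟩ := hv
  have hconst : HasDerivAt (Φ ∘ γ) 0 0 :=
    (hasDerivAt_const 0 (Φ (γ 0))).congr_of_eventuallyEq hγΦ
  exact (hΦ.comp_hasDerivAt 0 hγ).unique hconst

theorem mem_tangentSpaceAt_of_apply_eq_zero [CompleteSpace E] [FiniteDimensional ℝ F]
    {Φ' : E →L[ℝ] F} {x v : E} (hΦ : HasStrictFDerivAt Φ Φ' x) (hsurj : Function.Surjective Φ')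
    (hv : Φ' v = 0) : v ∈ tangentSpaceAt {y | Φ y = Φ x} x := by
  have hrange : Φ'.range = ⊤ := LinearMap.range_eq_top.2 hsurj
  let line (t : ℝ) : Φ'.ker := t • ⟨v, hv⟩
  have hline : HasDerivAt line ⟨v, hv⟩ 0 := by
    simpa [line] using (hasDerivAt_id (0 : ℝ)).smul_const (⟨v, hv⟩ : Φ'.ker)
  have hline0 : line 0 = 0 := zero_smul ℝ _
  have hlim : Filter.Tendsto (fun t => (Φ x, line t)) (𝓝 0) (𝓝 (Φ x, 0)) :=
    tendsto_const_nhds.prodMk_nhds (hline0 ▸ hline.continuousAt.tendsto)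
  have himplicit := (hΦ.to_implicitFunction hrange).hasFDerivAt
  rw [← hline0] at himplicit
  refine ⟨fun t => hΦ.implicitFunction Φ Φ' hrange (Φ x) (line t), ?_,
    hlim.eventually (hΦ.map_implicitFunction_eq hrange), himplicit.comp_hasDerivAt 0 hline⟩
  simp [hline0]

theorem tangentSpaceAt_levelSet [CompleteSpace E] [FiniteDimensional ℝ F] {Φ' : E →L[ℝ] F} {x : E}
    (hΦ : HasStrictFDerivAt Φ Φ' x) (hsurj : Function.Surjective Φ') :
    tangentSpaceAt {y | Φ y = Φ x} x = Φ'.ker :=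
  Set.ext fun _ => ⟨apply_eq_zero_of_mem_tangentSpaceAt hΦ.hasFDerivAt,
    mem_tangentSpaceAt_of_apply_eq_zero hΦ hsurj⟩

theorem isSubmanifold_levelSet [FiniteDimensional ℝ F] {c : F} {d : ℕ} (hΦ : ContDiff ℝ ∞ Φ)
    (hsurj : ∀ x, Φ x = c → Function.Surjective (fderiv ℝ Φ x))
    (hdim : {x | Φ x = c}.Nonempty → Module.finrank ℝ F + d = Module.finrank ℝ E) :
    IsSubmanifold {x | Φ x = c} d := by
  intro x hx
  let e : F ≃L[ℝ] (Fin (Module.finrank ℝ F) → ℝ) := (Module.finBasis ℝ F).equivFunL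
  have hderiv : HasFDerivAt (fun y => e (Φ y - c)) ((e : F →L[ℝ] _) ∘L fderiv ℝ Φ x) x :=
    e.hasFDerivAt.comp x
      ((hΦ.differentiable (by simp)).differentiableAt.hasFDerivAt.sub_const c)
  refine ⟨_, Set.univ, fun y => e (Φ y - c), hdim ⟨x, hx⟩, isOpen_univ, Set.mem_univ x,
    (e.contDiff.comp (hΦ.sub contDiff_const)).contDiffOn, ?_, by simp [sub_eq_zero]⟩
  rw [hderiv.fderiv]
  exact e.surjective.comp (hsurj x hx)

end LevelSet

variable {E : Type*} [NormedAddCommGroup E] [NormedSpace ℝ E]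

theorem IsSmoothOn.differentiableWithinAt {M : Set E} {f : E → ℝ} {x : E} (hf : IsSmoothOn M f)
    (hx : x ∈ M) : DifferentiableWithinAt ℝ f M x := by
  obtain ⟨U, F, hU, hxU, hF, hEq⟩ := hf x hx
  have hFx : DifferentiableAt ℝ F x := (hF.contDiffAt (hU.mem_nhds hxU)).differentiableAt (by simp)
  have hFf : F =ᶠ[𝓝[M] x] f :=
    hEq.eventuallyEq_of_mem (Filter.inter_mem (mem_nhdsWithin_of_mem_nhds (hU.mem_nhds hxU))
      self_mem_nhdsWithin)
  exact hFx.differentiableWithinAt.congr_of_eventuallyEq hFf.symm (hEq ⟨hxU, hx⟩).symm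

theorem differential_eq_of_subset {M N : Set E} (hMN : M ⊆ N) {f : E → ℝ} {x v : E}
    (hf : DifferentiableWithinAt ℝ f N x) (hv : v ∈ tangentSpaceAt M x) :
    differential M f x v = differential N f x v := by
  obtain ⟨γ, rfl, hγM, hγ⟩ := hv
  exact ((hf.mono hMN).hasFDerivWithinAt.comp_hasDerivAt 0 hγ hγM).unique
    (hf.hasFDerivWithinAt.comp_hasDerivAt 0 hγ (hγM.mono fun _ h => hMN h))

/-- The exterior derivative `dForm α x` as a bilinear form. -/
def dFormBilin (α : E → E →L[ℝ] ℝ) (x : E) : LinearMap.BilinForm ℝ E :=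
  LinearMap.mk₂ ℝ (dForm α x)
    (fun u v w => by simp only [dForm, map_add, add_apply]; ring)
    (fun c v w => by simp only [dForm, map_smul, smul_apply, smul_eq_mul]; ring)
    (fun u v w => by simp only [dForm, map_add, add_apply]; ring)
    (fun c v w => by simp only [dForm, map_smul, smul_apply, smul_eq_mul]; ring)

theorem dFormBilin_apply (α : E → E →L[ℝ] ℝ) (x v w : E) :
    dFormBilin α x v w = dForm α x v w := rfl

theorem isAlt_dFormBilin (α : E → E →L[ℝ] ℝ) (x : E) : (dFormBilin α x).IsAlt :=
  fun _ => sub_self _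

section IsLinearMap

variable [FiniteDimensional ℝ E] {α : E → E →L[ℝ] ℝ}

theorem contDiff_of_isLinearMap (hα : IsLinearMap ℝ α) : ContDiff ℝ ∞ α :=
  (LinearMap.toContinuousLinearMap (hα.mk' α)).contDiff

theorem dForm_of_isLinearMap (hα : IsLinearMap ℝ α) (x v w : E) :
    dForm α x v w = α v w - α w v := by
  have hfderiv : fderiv ℝ α x = LinearMap.toContinuousLinearMap (hα.mk' α) :=
    (LinearMap.toContinuousLinearMap (hα.mk' α)).fderiv
  simp [dForm, hfderiv]

end IsLinearMap

/-- The horizontal part `df - Z(f) α` of the differential of a function on `(M, α|_M)`, the form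
that `horizontalHam` is dual to. -/
def horizontalDifferential (M : Set E) (α : E → E →L[ℝ] ℝ) (f : E → ℝ) (x v : E) : ℝ :=
  differential M f x v - differential M f x (reeb M α x) * α x v

/-- `(M, α|_M)` is contact at `x`, with tangent space `T` and Reeb vector `Z`. -/
structure IsContactAt (M : Set E) (α : E → E →L[ℝ] ℝ) (x : E) (T : Submodule ℝ E) (Z : E) : Prop
    extends IsLinearContact T (α x : Module.Dual ℝ E) (dFormBilin α x) Z where
  tangentSpaceAt_eq : tangentSpaceAt M x = T

theorem isContact_of_isContactAt {M : Set E} {α : E → E →L[ℝ] ℝ} {m : ℕ} (hα : ContDiff ℝ ∞ α)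
    (hM : IsSubmanifold M (2 * m + 1)) {T : E → Submodule ℝ E} {Z : E → E}
    (h : ∀ x ∈ M, IsContactAt M α x (T x) (Z x)) : IsContact M α m where
  contDiff := hα
  submanifold := hM
  transverse x hx := by
    rw [(h x hx).tangentSpaceAt_eq]
    exact ⟨Z x, (h x hx).reeb_mem, (h x hx).form_reeb.trans_ne one_ne_zero⟩
  nondegenerate x hx := by
    rw [(h x hx).tangentSpaceAt_eq]
    exact fun _ => (h x hx).eq_zero_of_horizontal

namespace IsContactAt

variable {M N : Set E} {α : E → E →L[ℝ] ℝ} {x V W Z : E} {T : Submodule ℝ E} {f g : E → ℝ}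

theorem isReebAt (h : IsContactAt M α x T Z) : IsReebAt M α x Z := by
  rw [IsReebAt, h.tangentSpaceAt_eq]
  exact ⟨h.reeb_mem, h.form_reeb, h.reeb_left⟩

theorem reeb_eq (h : IsContactAt M α x T Z) : reeb M α x = Z := by
  have hreeb : IsReebAt M α x (reeb M α x) := Classical.epsilon_spec ⟨Z, h.isReebAt⟩
  rw [IsReebAt, h.tangentSpaceAt_eq] at hreeb
  exact h.reeb_unique hreeb.1 hreeb.2.1 hreeb.2.2

theorem horizontalDifferential_eq_differential (h : IsContactAt M α x T Z)
    (hf : differential M f x Z = 0) : horizontalDifferential M α f x = differential M f x := by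
  ext v
  rw [horizontalDifferential, h.reeb_eq, hf, zero_mul, sub_zero]

section Hamiltonian

variable [FiniteDimensional ℝ E]

theorem horizontalHam_spec (h : IsContactAt M α x T Z) (f : E → ℝ) :
    horizontalHam M α f x ∈ T ∧ α x (horizontalHam M α f x) = 0 ∧
      ∀ w ∈ T, -dForm α x (horizontalHam M α f x) w = horizontalDifferential M α f x w := by
  obtain ⟨Y, hY⟩ := h.exists_horizontal (fderivWithin ℝ f M x : Module.Dual ℝ E)
  rw [← h.reeb_eq] at hY
  rw [horizontalHam, h.tangentSpaceAt_eq]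
  exact Classical.epsilon_spec (p := fun Y => Y ∈ T ∧ α x Y = 0 ∧ ∀ w ∈ T, -dForm α x Y w =
    differential M f x w - differential M f x (reeb M α x) * α x w) ⟨Y, hY⟩

theorem horizontalHam_mem (h : IsContactAt M α x T Z) (f : E → ℝ) : horizontalHam M α f x ∈ T :=
  (h.horizontalHam_spec f).1

theorem dForm_horizontalHam (h : IsContactAt M α x T Z) (f : E → ℝ) {w : E} (hw : w ∈ T) :
    dForm α x (horizontalHam M α f x) w = -horizontalDifferential M α f x w :=
  neg_eq_iff_eq_neg.1 ((h.horizontalHam_spec f).2.2 w hw)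

theorem jacobiBracket_eq (h : IsContactAt M α x T Z) (f g : E → ℝ) :
    jacobiBracket M α f g x = dForm α x (horizontalHam M α f x) (horizontalHam M α g x)
      + f x * differential M g x Z - g x * differential M f x Z := by
  have hreeb : dFormBilin α x Z (horizontalHam M α g x) = 0 :=
    h.reeb_left _ (h.horizontalHam_mem g)
  have hreeb' : dFormBilin α x (horizontalHam M α f x) Z = 0 :=
    h.reeb_right (h.horizontalHam_mem f)
  rw [jacobiBracket, contactHam, contactHam, h.reeb_eq, ← dFormBilin_apply, ← dFormBilin_apply]
  simp only [map_add, map_smul, LinearMap.add_apply, LinearMap.smul_apply, hreeb, hreeb',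
    h.isAlt.self_eq_zero, smul_zero, add_zero, zero_add]

end Hamiltonian

theorem restrict (h : IsContactAt N α x T Z) (hV : V ∈ T) (hW : W ∈ T)
    (hVW : dForm α x V W ≠ 0)
    (hM : tangentSpaceAt M x = skewComplement T (dFormBilin α x) V W) :
    IsContactAt M α x (skewComplement T (dFormBilin α x) V W) Z where
  toIsLinearContact := h.skewComplement hV hW hVW
  tangentSpaceAt_eq := hM

theorem jacobiBracket_restrict [FiniteDimensional ℝ E] (h : IsContactAt N α x T Z) (hV : V ∈ T)
    (hW : W ∈ T) (hVW : dForm α x V W ≠ 0) (hMN : M ⊆ N)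
    (hM : tangentSpaceAt M x = skewComplement T (dFormBilin α x) V W)
    (hf : DifferentiableWithinAt ℝ f N x) (hg : DifferentiableWithinAt ℝ g N x) :
    jacobiBracket M α f g x = jacobiBracket N α f g x +
      (horizontalDifferential N α f x W * horizontalDifferential N α g x V -
        horizontalDifferential N α f x V * horizontalDifferential N α g x W) /
        dForm α x V W := by
  have h' := h.restrict hV hW hVW hM
  have hdiff {φ : E → ℝ} (hφ : DifferentiableWithinAt ℝ φ N x) {w : E}
      (hw : w ∈ skewComplement T (dFormBilin α x) V W) :
      differential M φ x w = differential N φ x w :=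
    differential_eq_of_subset hMN hφ (hM ▸ hw)
  have hham {φ : E → ℝ} (hφ : DifferentiableWithinAt ℝ φ N x) :
      ∀ w ∈ skewComplement T (dFormBilin α x) V W,
        dForm α x (horizontalHam M α φ x) w = dForm α x (horizontalHam N α φ x) w := by
    intro w hw
    rw [h'.dForm_horizontalHam φ hw, h.dForm_horizontalHam φ (mem_skewComplement.1 hw).1,
      horizontalDifferential, horizontalDifferential, h.reeb_eq, h'.reeb_eq, hdiff hφ hw,
      hdiff hφ h'.reeb_mem]
  have hbracket := apply_eq_of_eqOn_skewComplement h.isAlt hV hW hVW (h.horizontalHam_mem g)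
    (h'.horizontalHam_mem f) (hham hf) (hham hg)
  simp only [dFormBilin_apply, h.dForm_horizontalHam _ hV, h.dForm_horizontalHam _ hW,
    neg_mul_neg] at hbracket
  rw [h.jacobiBracket_eq, h'.jacobiBracket_eq, hbracket, hdiff hf h'.reeb_mem,
    hdiff hg h'.reeb_mem]
  ring

end IsContactAt

end ContactGeometry

section WeightedInnerProduct

variable {ι : Type*} [Fintype ι] {w : ι → ℝ}

/-- The pairing `⟪v, ·⟫_[ℂ, w]` as a real linear map. -/
def wInnerCLM (w : ι → ℝ) (v : ι → ℂ) : (ι → ℂ) →L[ℝ] ℂ :=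
  LinearMap.toContinuousLinearMap
    { toFun := wInner w v
      map_add' := RCLike.wInner_add_right w v
      map_smul' := fun c => RCLike.wInner_smul_right c w v }

@[simp]
theorem wInnerCLM_apply (v u : ι → ℂ) : wInnerCLM w v u = ⟪v, u⟫_[ℂ, w] := rfl

theorem wInner_self (v : ι → ℂ) : ⟪v, v⟫_[ℂ, w] = ((∑ j, w j * ‖v j‖ ^ 2 : ℝ) : ℂ) := by
  simp [wInner]

theorem wInner_self_ne_zero (hw : ∀ j, 0 < w j) {v : ι → ℂ} (hv : v ≠ 0) :
    ⟪v, v⟫_[ℂ, w] ≠ 0 := by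
  obtain ⟨k, hk⟩ := Function.ne_iff.1 hv
  rw [wInner_self, Complex.ofReal_ne_zero]
  exact (Finset.sum_pos' (fun j _ => mul_nonneg (hw j).le (sq_nonneg ‖v j‖))
    ⟨k, Finset.mem_univ k, mul_pos (hw k) (pow_pos (norm_pos_iff.2 hk) 2)⟩).ne'

theorem hasStrictFDerivAt_sum_norm_sq (z : ι → ℂ) :
    HasStrictFDerivAt (fun u : ι → ℂ => ∑ j, ‖u j‖ ^ 2)
      ((2 : ℝ) • (Complex.reCLM ∘L wInnerCLM 1 z)) z := by
  have hsum : HasStrictFDerivAt (fun u : ι → ℂ => ∑ j, ‖u j‖ ^ 2)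
      (∑ j, (2 • innerSL ℝ (z j)) ∘L ContinuousLinearMap.proj (R := ℝ) (φ := fun _ => ℂ) j) z :=
    HasStrictFDerivAt.fun_sum fun j _ => (hasStrictFDerivAt_norm_sq (z j)).comp z
      (ContinuousLinearMap.proj (R := ℝ) (φ := fun _ => ℂ) j).hasStrictFDerivAt
  refine hsum.congr_fderiv ?_
  ext v
  simp [RCLike.wInner_one_eq_sum, two_smul, Finset.sum_add_distrib]

end WeightedInnerProduct

namespace Brieskorn

open ContactGeometry

variable {n : ℕ} {a : Fin (n + 1) → ℕ} {z : Fin (n + 1) → ℂ}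

/-- The exponents as weights: up to constants `α` and `dα` are the imaginary part of the Hermitian
form `⟪·, ·⟫_[ℂ, weight a]`. -/
abbrev weight (a : Fin (n + 1) → ℕ) (j : Fin (n + 1)) : ℝ := a j

/-- The gradient of `∑ z_j ^ a_j` with respect to `⟪·, ·⟫_[ℂ, weight a]`. -/
def powGradient (a : Fin (n + 1) → ℕ) (z : Fin (n + 1) → ℂ) : Fin (n + 1) → ℂ :=
  fun j => conj (z j) ^ (a j - 1)

theorem V₁_eq : V₁ a z = (2 * Complex.I) • powGradient a z := rfl

theorem V₂_eq : V₂ a z = (-2 : ℂ) • powGradient a z := rfl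

theorem form_apply (v : Fin (n + 1) → ℂ) :
    form a z v = (1 / 4 : ℝ) * (⟪z, v⟫_[ℂ, weight a]).im := by
  simp [form, wInner, sub_eq_add_neg, mul_comm, add_comm, mul_add]

theorem isLinearMap_form (a : Fin (n + 1) → ℕ) : IsLinearMap ℝ (form a) where
  map_add z z' := by ext v; simp [form_apply, RCLike.wInner_add_left, mul_add]
  map_smul c z := by ext v; simp [form_apply, RCLike.wInner_smul_left, mul_left_comm]

theorem dForm_form (v w : Fin (n + 1) → ℂ) :
    dForm (form a) z v w = (1 / 2 : ℝ) * (⟪v, w⟫_[ℂ, weight a]).im := by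
  rw [dForm_of_isLinearMap (isLinearMap_form a), form_apply, form_apply,
    ← RCLike.conj_wInner_symm (weight a) v w, Complex.conj_im]
  ring

theorem wInner_one_powGradient (ha : ∀ j, 0 < a j) :
    ⟪z, powGradient a z⟫_[ℂ] = conj (∑ j, z j ^ a j) := by
  rw [RCLike.wInner_one_eq_sum, map_sum]
  refine Finset.sum_congr rfl fun j _ => ?_
  rw [RCLike.inner_apply, powGradient, map_pow, pow_sub_one_mul (ha j).ne']

theorem wInner_powGradient_self :
    ⟪powGradient a z, powGradient a z⟫_[ℂ, weight a] = (mu a z : ℂ) / 2 := by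
  simp [wInner_self, mu, powGradient, mul_comm 2, pow_mul]

theorem powGradient_ne_zero (hz : z ≠ 0) : powGradient a z ≠ 0 := by
  obtain ⟨j, hj⟩ := Function.ne_iff.1 hz
  exact Function.ne_iff.2 ⟨j, pow_ne_zero _ ((map_ne_zero _).2 hj)⟩

theorem mu_ne_zero (ha : ∀ j, 0 < a j) (hz : z ≠ 0) : mu a z ≠ 0 := by
  have hself := wInner_self_ne_zero (w := weight a) (fun j => Nat.cast_pos.2 (ha j))
    (powGradient_ne_zero (a := a) hz)
  rw [wInner_powGradient_self] at hself
  exact Complex.ofReal_ne_zero.1 (div_ne_zero_iff.1 hself).1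

theorem dForm_V₁ (w : Fin (n + 1) → ℂ) :
    dForm (form a) z (V₁ a z) w = -(⟪powGradient a z, w⟫_[ℂ, weight a]).re := by
  simp [dForm_form, V₁_eq, RCLike.wInner_smul_left]

theorem dForm_V₂ (w : Fin (n + 1) → ℂ) :
    dForm (form a) z (V₂ a z) w = -(⟪powGradient a z, w⟫_[ℂ, weight a]).im := by
  simp [dForm_form, V₂_eq, RCLike.wInner_smul_left]

theorem dForm_V₁_V₂ : dForm (form a) z (V₁ a z) (V₂ a z) = mu a z := by
  simp [dForm_V₁, V₂_eq, RCLike.wInner_smul_right, wInner_powGradient_self,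
    mul_div_cancel₀]

theorem wInner_reebField (ha : ∀ j, 0 < a j) (w : Fin (n + 1) → ℂ) :
    ⟪reebField a z, w⟫_[ℂ, weight a] = -4 * Complex.I * ⟪z, w⟫_[ℂ] := by
  rw [wInner, RCLike.wInner_one_eq_sum, Finset.mul_sum]
  refine Finset.sum_congr rfl fun j _ => ?_
  have haj : (a j : ℂ) ≠ 0 := Nat.cast_ne_zero.2 (ha j).ne'
  simp only [reebField, RCLike.inner_apply, map_mul, map_div₀, map_ofNat, Complex.conj_I,
    map_natCast, Complex.real_smul, Complex.ofReal_natCast]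
  field_simp

theorem dForm_reebField (ha : ∀ j, 0 < a j) (w : Fin (n + 1) → ℂ) :
    dForm (form a) z (reebField a z) w = -2 * (⟪z, w⟫_[ℂ]).re := by
  rw [dForm_form, wInner_reebField ha, mul_assoc, ← Complex.ofReal_ofNat, ← Complex.ofReal_neg,
    Complex.im_ofReal_mul, Complex.I_mul_im]
  ring

theorem form_reebField (ha : ∀ j, 0 < a j) :
    form a z (reebField a z) = (⟪z, z⟫_[ℂ]).re := by
  rw [form_apply, ← RCLike.conj_wInner_symm, wInner_reebField ha]
  simp

theorem wInner_one_self (hz : z ∈ unitSphere n) : ⟪z, z⟫_[ℂ] = 1 := by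
  have hsum : ∑ j, ‖z j‖ ^ 2 = 1 := hz
  simp only [wInner_self, Pi.one_apply, one_mul, hsum, Complex.ofReal_one]

theorem manifold_subset_unitSphere : manifold a ⊆ unitSphere n := fun _ hz => hz.1

theorem ne_zero_of_mem_unitSphere (hz : z ∈ unitSphere n) : z ≠ 0 := by
  rintro rfl
  simpa using wInner_one_self hz

theorem pos_of_mem_manifold (hz : z ∈ manifold a) : 0 < n := by
  rcases n.eq_zero_or_pos with rfl | hn
  · obtain ⟨hnorm, hpow⟩ := hz
    rw [Fin.sum_univ_one] at hnorm hpow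
    simp [eq_zero_of_pow_eq_zero hpow] at hnorm
  · exact hn

/-- The tangent space of the unit sphere at `z`. -/
def sphereTangent (z : Fin (n + 1) → ℂ) : Submodule ℝ (Fin (n + 1) → ℂ) :=
  (Complex.reCLM ∘L wInnerCLM 1 z).ker

theorem mem_sphereTangent {v : Fin (n + 1) → ℂ} : v ∈ sphereTangent z ↔ (⟪z, v⟫_[ℂ]).re = 0 :=
  Iff.rfl

theorem V₁_mem_sphereTangent (ha : ∀ j, 0 < a j) (hz : z ∈ manifold a) :
    V₁ a z ∈ sphereTangent z := by
  rw [mem_sphereTangent, V₁_eq, RCLike.wInner_smul_right, wInner_one_powGradient ha, hz.2]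
  simp

theorem V₂_mem_sphereTangent (ha : ∀ j, 0 < a j) (hz : z ∈ manifold a) :
    V₂ a z ∈ sphereTangent z := by
  rw [mem_sphereTangent, V₂_eq, RCLike.wInner_smul_right, wInner_one_powGradient ha, hz.2]
  simp

theorem isLinearContact_sphereTangent (ha : ∀ j, 0 < a j) (hz : z ∈ unitSphere n) :
    IsLinearContact (sphereTangent z) (form a z : Module.Dual ℝ (Fin (n + 1) → ℂ))
      (dFormBilin (form a) z) (reebField a z) where
  isAlt := isAlt_dFormBilin _ _
  reeb_mem := by
    have hself := isAlt_dFormBilin (form a) z (reebField a z)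
    rw [dFormBilin_apply, dForm_reebField ha] at hself
    exact mem_sphereTangent.2 (by linarith)
  form_reeb := (form_reebField ha).trans (by rw [wInner_one_self hz, Complex.one_re])
  reeb_left w hw := (dForm_reebField ha w).trans (by rw [mem_sphereTangent.1 hw, mul_zero])
  nondegenerate v _ hαv hΩv := by
    -- `dα(v, ·)` vanishes at `z`, as `α_z(v) = 0`, and takes a multiple of `⟪v, v⟫` at `i v`.
    let r := (⟪z, Complex.I • v⟫_[ℂ]).re
    have hαv : (⟪z, v⟫_[ℂ, weight a]).im = 0 := by simpa [form_apply] using hαv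
    have hvz : (⟪v, z⟫_[ℂ, weight a]).im = 0 := by
      rw [← RCLike.conj_wInner_symm, Complex.conj_im, hαv, neg_zero]
    have htangent : Complex.I • v - r • z ∈ sphereTangent z := by
      simp [mem_sphereTangent, RCLike.wInner_sub_right, RCLike.wInner_smul_right (𝕝 := ℝ),
        wInner_one_self hz, r]
    have hself := hΩv _ htangent
    rw [dFormBilin_apply, dForm_form, RCLike.wInner_sub_right, RCLike.wInner_smul_right,
      RCLike.wInner_smul_right, wInner_self, Complex.sub_im, smul_eq_mul, Complex.I_mul_im,
      Complex.ofReal_re, Complex.smul_im, hvz, smul_zero, sub_zero] at hself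
    by_contra hv
    refine wInner_self_ne_zero (w := weight a) (fun j => Nat.cast_pos.2 (ha j)) hv ?_
    rw [wInner_self, (mul_eq_zero.1 hself).resolve_left (by norm_num), Complex.ofReal_zero]

theorem surjective_two_smul_re_wInnerCLM (hz : z ∈ unitSphere n) :
    Function.Surjective ((2 : ℝ) • (Complex.reCLM ∘L wInnerCLM 1 z)) := fun t =>
  ⟨(t / 2) • z, by simp [wInner_one_self hz]⟩

theorem finrank_complexSpace : Module.finrank ℝ (Fin (n + 1) → ℂ) = 2 * (n + 1) := by
  rw [finrank_real_of_complex, Module.finrank_fin_fun]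

theorem isSubmanifold_unitSphere : IsSubmanifold (unitSphere n) (2 * n + 1) := by
  refine isSubmanifold_levelSet (Φ := fun z : Fin (n + 1) → ℂ => ∑ j, ‖z j‖ ^ 2)
    (ContDiff.sum fun j _ => (contDiff_apply ℝ ℂ j).norm_sq ℝ) (fun z hz => ?_) fun _ => ?_
  · rw [(hasStrictFDerivAt_sum_norm_sq z).hasFDerivAt.fderiv]
    exact surjective_two_smul_re_wInnerCLM hz
  · rw [finrank_complexSpace, Module.finrank_self]
    ring

theorem isContactAt_unitSphere (ha : ∀ j, 0 < a j) (hz : z ∈ unitSphere n) :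
    IsContactAt (unitSphere n) (form a) z (sphereTangent z) (reebField a z) where
  toIsLinearContact := isLinearContact_sphereTangent ha hz
  tangentSpaceAt_eq := by
    have htangent := tangentSpaceAt_levelSet (hasStrictFDerivAt_sum_norm_sq z)
      (surjective_two_smul_re_wInnerCLM hz)
    have hz' : ∑ j, ‖z j‖ ^ 2 = 1 := hz
    rw [hz'] at htangent
    refine htangent.trans (Set.ext fun v => ?_)
    simp [mem_sphereTangent]

/-- The defining map of the Brieskorn manifold, which is its fibre over `(1, 0)`. -/
def brieskornMap (a : Fin (n + 1) → ℕ) (z : Fin (n + 1) → ℂ) : ℝ × ℂ :=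
  (∑ j, ‖z j‖ ^ 2, ∑ j, z j ^ a j)

/-- The derivative of `brieskornMap a` at `z`. -/
def brieskornDeriv (a : Fin (n + 1) → ℕ) (z : Fin (n + 1) → ℂ) :
    (Fin (n + 1) → ℂ) →L[ℝ] ℝ × ℂ :=
  ((2 : ℝ) • (Complex.reCLM ∘L wInnerCLM 1 z)).prod (wInnerCLM (weight a) (powGradient a z))

theorem manifold_eq (a : Fin (n + 1) → ℕ) : manifold a = {z | brieskornMap a z = (1, 0)} := by
  ext z
  simp [manifold, brieskornMap]

theorem contDiff_brieskornMap (a : Fin (n + 1) → ℕ) : ContDiff ℝ ∞ (brieskornMap a) :=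
  (ContDiff.sum fun j _ => (contDiff_apply ℝ ℂ j).norm_sq ℝ).prodMk
    (ContDiff.sum fun j _ => (contDiff_apply ℝ ℂ j).pow _)

theorem hasStrictFDerivAt_brieskornMap (a : Fin (n + 1) → ℕ) (z : Fin (n + 1) → ℂ) :
    HasStrictFDerivAt (brieskornMap a) (brieskornDeriv a z) z := by
  have hpow := HasStrictFDerivAt.fun_sum (u := Finset.univ) fun j _ =>
    (ContinuousLinearMap.proj (R := ℝ) (φ := fun _ => ℂ) j).hasStrictFDerivAt (x := z) |>.pow (a j)
  refine (hasStrictFDerivAt_sum_norm_sq z).prodMk (hpow.congr_fderiv ?_)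
  ext v
  simp [wInner, powGradient, mul_assoc, mul_comm (v _)]

theorem brieskornDeriv_surjective (ha : ∀ j, 0 < a j) (hz : z ∈ manifold a) :
    Function.Surjective (brieskornDeriv a z) := by
  rintro ⟨t, p⟩
  have hself : ⟪powGradient a z, powGradient a z⟫_[ℂ, weight a] ≠ 0 :=
    wInner_self_ne_zero (fun j => Nat.cast_pos.2 (ha j))
      (powGradient_ne_zero (ne_zero_of_mem_unitSphere hz.1))
  let s : ℂ := (p - (t / 2) * ⟪powGradient a z, z⟫_[ℂ, weight a]) /
    ⟪powGradient a z, powGradient a z⟫_[ℂ, weight a]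
  refine ⟨(t / 2 : ℂ) • z + s • powGradient a z, Prod.ext ?_ ?_⟩
  · simp [brieskornDeriv, RCLike.wInner_add_right, RCLike.wInner_smul_right,
      wInner_one_self hz.1, wInner_one_powGradient ha, hz.2, mul_div_cancel₀]
  · simp [brieskornDeriv, RCLike.wInner_add_right, RCLike.wInner_smul_right, s, hself]

theorem isSubmanifold_manifold (ha : ∀ j, 0 < a j) :
    IsSubmanifold (manifold a) (2 * (n - 1) + 1) := by
  rw [manifold_eq]
  refine isSubmanifold_levelSet (contDiff_brieskornMap a) (fun z hz => ?_) fun ⟨z, hz⟩ => ?_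
  · rw [(hasStrictFDerivAt_brieskornMap a z).hasFDerivAt.fderiv]
    exact brieskornDeriv_surjective ha (manifold_eq a ▸ hz)
  · have hn := pos_of_mem_manifold (manifold_eq a ▸ hz)
    rw [finrank_complexSpace, Module.finrank_prod, Module.finrank_self,
      Complex.finrank_real_complex]
    lia

theorem tangentSpaceAt_manifold (ha : ∀ j, 0 < a j) (hz : z ∈ manifold a) :
    tangentSpaceAt (manifold a) z =
      skewComplement (sphereTangent z) (dFormBilin (form a) z) (V₁ a z) (V₂ a z) := by
  have htangent := tangentSpaceAt_levelSet (hasStrictFDerivAt_brieskornMap a z)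
    (brieskornDeriv_surjective ha hz)
  have hz' := hz
  rw [manifold_eq, Set.mem_ofPred_eq] at hz'
  rw [hz', ← manifold_eq] at htangent
  refine htangent.trans (Set.ext fun v => ?_)
  simp [mem_skewComplement, mem_sphereTangent, dFormBilin_apply, dForm_V₁, dForm_V₂,
    brieskornDeriv, Complex.ext_iff]

theorem dForm_V₁_V₂_ne_zero (ha : ∀ j, 0 < a j) (hz : z ∈ manifold a) :
    dForm (form a) z (V₁ a z) (V₂ a z) ≠ 0 :=
  dForm_V₁_V₂.trans_ne (mu_ne_zero ha (ne_zero_of_mem_unitSphere hz.1))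

theorem isContactAt_manifold (ha : ∀ j, 0 < a j) (hz : z ∈ manifold a) :
    IsContactAt (manifold a) (form a) z
      (skewComplement (sphereTangent z) (dFormBilin (form a) z) (V₁ a z) (V₂ a z))
      (reebField a z) :=
  (isContactAt_unitSphere ha hz.1).restrict (V₁_mem_sphereTangent ha hz)
    (V₂_mem_sphereTangent ha hz) (dForm_V₁_V₂_ne_zero ha hz) (tangentSpaceAt_manifold ha hz)

theorem jacobiBracket_manifold (ha : ∀ j, 0 < a j) (hz : z ∈ manifold a)
    {f g : (Fin (n + 1) → ℂ) → ℝ} (hf : DifferentiableWithinAt ℝ f (unitSphere n) z)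
    (hg : DifferentiableWithinAt ℝ g (unitSphere n) z) :
    jacobiBracket (manifold a) (form a) f g z = jacobiBracket (unitSphere n) (form a) f g z +
      (horizontalDifferential (unitSphere n) (form a) f z (V₂ a z) *
          horizontalDifferential (unitSphere n) (form a) g z (V₁ a z) -
        horizontalDifferential (unitSphere n) (form a) f z (V₁ a z) *
          horizontalDifferential (unitSphere n) (form a) g z (V₂ a z)) / mu a z := by
  rw [← dForm_V₁_V₂]
  exact (isContactAt_unitSphere ha hz.1).jacobiBracket_restrict (V₁_mem_sphereTangent ha hz)
    (V₂_mem_sphereTangent ha hz) (dForm_V₁_V₂_ne_zero ha hz) manifold_subset_unitSphere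
    (tangentSpaceAt_manifold ha hz) hf hg

end Brieskorn

end

open ContactGeometry Brieskorn in
theorem theorem4p1_general (n : ℕ) (a : Fin (n + 1) → ℕ) (ha : ∀ j, 0 < a j) :
    IsContact (unitSphere n) (form a) n ∧
    IsContact (manifold a) (form a) (n - 1) ∧
    (∀ z ∈ unitSphere n, IsReebAt (unitSphere n) (form a) z (reebField a z)) ∧
    (∀ z ∈ manifold a, IsReebAt (manifold a) (form a) z (reebField a z)) ∧
    (∀ z ∈ manifold a,
      V₁ a z ∈ tangentSpaceAt (unitSphere n) z ∧
      V₂ a z ∈ tangentSpaceAt (unitSphere n) z ∧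
      mu a z = 2 * ∑ j, (a j : ℝ) * (‖z j‖ ^ 2) ^ (a j - 1) ∧
      mu a z ≠ 0) ∧
    ∀ z ∈ manifold a, ∀ f g : (Fin (n + 1) → ℂ) → ℝ,
      DifferentiableWithinAt ℝ f (unitSphere n) z →
      DifferentiableWithinAt ℝ g (unitSphere n) z →
      jacobiBracket (manifold a) (form a) f g z = jacobiBracket (unitSphere n) (form a) f g z +
        (horizontalDifferential (unitSphere n) (form a) f z (V₂ a z) *
            horizontalDifferential (unitSphere n) (form a) g z (V₁ a z) -
          horizontalDifferential (unitSphere n) (form a) f z (V₁ a z) *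
            horizontalDifferential (unitSphere n) (form a) g z (V₂ a z)) / mu a z := by
  have hα : ContDiff ℝ ∞ (form a) := contDiff_of_isLinearMap (isLinearMap_form a)
  refine ⟨isContact_of_isContactAt hα isSubmanifold_unitSphere fun _ => isContactAt_unitSphere ha,
    isContact_of_isContactAt hα (isSubmanifold_manifold ha) fun _ => isContactAt_manifold ha,
    fun _ hz => (isContactAt_unitSphere ha hz).isReebAt,
    fun _ hz => (isContactAt_manifold ha hz).isReebAt, fun z hz => ?_,
    fun _ hz _ _ => jacobiBracket_manifold ha hz⟩
  rw [(isContactAt_unitSphere ha hz.1).tangentSpaceAt_eq]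
  exact ⟨V₁_mem_sphereTangent ha hz, V₂_mem_sphereTangent ha hz, by simp only [mu, pow_mul],
    mu_ne_zero ha (ne_zero_of_mem_unitSphere hz.1)⟩

theorem theorem4p1 (n : ℕ) (a : Fin (n + 1) → ℕ) (ha : ∀ j, 0 < a j) :
    ContactGeometry.IsContact (Brieskorn.unitSphere n) (Brieskorn.form a) n ∧
    ContactGeometry.IsContact (Brieskorn.manifold a) (Brieskorn.form a) (n - 1) ∧
    (∀ z ∈ Brieskorn.unitSphere n, ContactGeometry.IsReebAt (Brieskorn.unitSphere n)
      (Brieskorn.form a) z (Brieskorn.reebField a z)) ∧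
    (∀ z ∈ Brieskorn.manifold a, ContactGeometry.IsReebAt (Brieskorn.manifold a)
      (Brieskorn.form a) z (Brieskorn.reebField a z)) ∧
    (∀ z ∈ Brieskorn.manifold a,
      Brieskorn.V₁ a z ∈ ContactGeometry.tangentSpaceAt (Brieskorn.unitSphere n) z ∧
      Brieskorn.V₂ a z ∈ ContactGeometry.tangentSpaceAt (Brieskorn.unitSphere n) z ∧
      Brieskorn.mu a z = 2 * ∑ j, (a j : ℝ) * (‖z j‖ ^ 2) ^ (a j - 1) ∧
      Brieskorn.mu a z ≠ 0) ∧
    ∀ f g : (Fin (n + 1) → ℂ) → ℝ,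
      ContactGeometry.IsSmoothOn (Brieskorn.unitSphere n) f →
      ContactGeometry.IsSmoothOn (Brieskorn.unitSphere n) g →
      (∀ z ∈ Brieskorn.unitSphere n, ContactGeometry.differential (Brieskorn.unitSphere n) f z
        (Brieskorn.reebField a z) = 0) →
      (∀ z ∈ Brieskorn.unitSphere n, ContactGeometry.differential (Brieskorn.unitSphere n) g z
        (Brieskorn.reebField a z) = 0) →
      ∀ z ∈ Brieskorn.manifold a,
        ContactGeometry.jacobiBracket (Brieskorn.manifold a) (Brieskorn.form a) f g z =
          ContactGeometry.jacobiBracket (Brieskorn.unitSphere n) (Brieskorn.form a) f g z +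
          (ContactGeometry.differential (Brieskorn.unitSphere n) f z (Brieskorn.V₂ a z) *
              ContactGeometry.differential (Brieskorn.unitSphere n) g z (Brieskorn.V₁ a z) -
            ContactGeometry.differential (Brieskorn.unitSphere n) f z (Brieskorn.V₁ a z) *
              ContactGeometry.differential (Brieskorn.unitSphere n) g z (Brieskorn.V₂ a z)) /
            Brieskorn.mu a z := by
  obtain ⟨hS, hB, hSreeb, hBreeb, hV, hbracket⟩ := theorem4p1_general n a ha
  refine ⟨hS, hB, hSreeb, hBreeb, hV, fun f g hf hg hZf hZg z hz => ?_⟩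
  have hz' : z ∈ Brieskorn.unitSphere n := hz.1
  have hcontact := Brieskorn.isContactAt_unitSphere ha hz'
  rw [hbracket z hz f g (hf.differentiableWithinAt hz') (hg.differentiableWithinAt hz'),
    hcontact.horizontalDifferential_eq_differential (hZf z hz'),
    hcontact.horizontalDifferential_eq_differential (hZg z hz')]
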